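/- Let $d\in\mathbb N_0$, let $\mathcal H$ be a separable complex Hilbert space, and let $\nu:\mathbb R^d\to(0,\infty)$ be a continuous function which is submultiplicative ($\nu(x+y)\le\nu(x)\nu(y)$ for all $x,y\in\mathbb R^d$), symmetric ($\nu(-x)=\nu(x)$ for all $x\in\mathbb R^d$) and satisfies the Gelfand–Raikov–Shilov condition $\lim_{n\to\infty}\nu(nz)^{1/n}=1$ for all $z\in\mathbb R^d$. Let $\mathcal C_\nu$ be the space of all $\mathcal B(\mathcal H)$-valued matrices $A=[A_{k,l}]_{k,l\in\mathbb Z^d}$ with $$\|A\|_{\mathcal C_\nu}:=\sum_{l\in\mathbb Z^d}\ \sup_{k\in\mathbb Z^d}\|A_{k,k-l}\|\,\nu(l)<\infty ,$$ a unital Banach $*$-algebra with respect to this norm, matrix multiplication $[AB]_{k,l}=\sum_{n\in\mathbb Z^d}A_{k,n}B_{n,l}$ and the involution $[A^*]_{k,l}=(A_{l,k})^*$. It is regarded as a $*$-subalgebra of $\mathcal B(\ell^2(\mathbb Z^d;\mathcal H))$, with the same identity, by letting $A$ act as $(Af)_k=\sum_{l\in\mathbb Z^d}A_{k,l}f_l$.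 Then $\mathcal C_\nu\subseteq\mathcal B(\ell^2(\mathbb Z^d;\mathcal H))$ is a Wiener pair, that is, $\mathcal C_\nu$ is inverse-closed in $\mathcal B(\ell^2(\mathbb Z^d;\mathcal H))$: if $A\in\mathcal C_\nu$ is invertible in $\mathcal B(\ell^2(\mathbb Z^d;\mathcal H))$, then $A^{-1}\in\mathcal C_\nu$. In particular, $\mathcal C_\nu$ is a symmetric Banach algebra: for every $A\in\mathcal C_\nu$, the spectrum of $A^*A$ in $\mathcal C_\nu$ is contained in $[0,\infty)$. -/

import Mathlib

open scoped ENNReal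

noncomputable section

/-- A submultiplicative and symmetric weight on `ℝᵈ`: a continuous positive function `ν` with
`ν (x + y) ≤ ν x * ν y` and `ν (-x) = ν x`. -/
structure SubmulSymmWeight (d : ℕ) where
  toFun : EuclideanSpace ℝ (Fin d) → ℝ
  continuous' : Continuous toFun
  pos' : ∀ x, 0 < toFun x
  submul' : ∀ x y, toFun (x + y) ≤ toFun x * toFun y
  symm' : ∀ x, toFun x = toFun (-x)

/-- The Gelfand-Raikov-Shilov condition `lim_{n → ∞} ν (n z) ^ (1 / n) = 1` for all `z ∈ ℝᵈ`. -/
def SubmulSymmWeight.GRS {d : ℕ} (ν : SubmulSymmWeight d) : Prop :=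
  ∀ z : EuclideanSpace ℝ (Fin d),
    Filter.Tendsto (fun n : ℕ => (ν.toFun ((n : ℝ) • z)) ^ ((1 : ℝ) / (n : ℝ)))
      Filter.atTop (nhds 1)

/-- The lattice `ℤᵈ`. -/
abbrev IntLattice (d : ℕ) : Type := Fin d → ℤ

/-- A lattice point viewed as a point of `ℝᵈ`. -/
def latticePoint {d : ℕ} (l : IntLattice d) : EuclideanSpace ℝ (Fin d) :=
  WithLp.toLp 2 (fun i => (l i : ℝ))

/-- The value `ν l` at a lattice point, as an extended nonnegative number. -/
def SubmulSymmWeight.latticeVal {d : ℕ} (ν : SubmulSymmWeight d) (l : IntLattice d) : ℝ≥0∞ :=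
  ENNReal.ofReal (ν.toFun (latticePoint l))

/-- `B(H)`-valued matrices indexed by `ℤᵈ`. -/
abbrev OpMatrix (d : ℕ) (H : Type*) [NormedAddCommGroup H] [InnerProductSpace ℂ H] : Type _ :=
  IntLattice d → IntLattice d → (H →L[ℂ] H)

/-- The Hilbert space `ℓ²(ℤᵈ; H)`. -/
abbrev SeqL2 (d : ℕ) (H : Type*) [NormedAddCommGroup H] [InnerProductSpace ℂ H] : Type _ :=
  lp (fun _ : IntLattice d => H) 2

section Basic

variable {d : ℕ} {H : Type*} [NormedAddCommGroup H] [InnerProductSpace ℂ H]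

/-- The supremum `d_A l = sup_k ‖A_{k,k-l}‖` of the norms of the entries on the `l`-th side
diagonal. -/
def sideDiag (A : OpMatrix d H) (l : IntLattice d) : ℝ≥0∞ :=
  ⨆ k : IntLattice d, ‖A k (k - l)‖ₑ

/-- The weighted norm `∑_l sup_k ‖A_{k,k-l}‖ ν l`, with value in `[0, ∞]`. -/
def bgsENorm (ν : SubmulSymmWeight d) (A : OpMatrix d H) : ℝ≥0∞ :=
  ∑' l : IntLattice d, sideDiag A l * ν.latticeVal l

/-- The matrix product `(A B)_{k,l} = ∑_n A_{k,n} B_{n,l}`, with summation in the operator norm. -/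
def matMul (A B : OpMatrix d H) : OpMatrix d H :=
  fun k l => ∑' n : IntLattice d, A k n * B n l

/-- The identity matrix. -/
def matOne (d : ℕ) (H : Type*) [NormedAddCommGroup H] [InnerProductSpace ℂ H] : OpMatrix d H :=
  fun k l => if k = l then 1 else 0

/-- The adjoint matrix `(A^*)_{k,l} = (A_{l,k})^*`. -/
def matStar [CompleteSpace H] (A : OpMatrix d H) : OpMatrix d H :=
  fun k l => star (A l k)

/-- The bounded operator `T` on `ℓ²(ℤᵈ; H)` is given by the matrix `A`, that is,
`(T f)_k = ∑_l A_{k,l} f_l` for every `f` and `k`. -/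
def IsMatrixOf (A : OpMatrix d H) (T : SeqL2 d H →L[ℂ] SeqL2 d H) : Prop :=
  ∀ (f : SeqL2 d H) (k : IntLattice d), HasSum (fun l => A k l (f l)) (T f k)

theorem SubmulSymmWeight.one_le {d : ℕ} (ν : SubmulSymmWeight d)
    (x : EuclideanSpace ℝ (Fin d)) : 1 ≤ ν.toFun x := by
  have h0 : 1 ≤ ν.toFun 0 := by
    have h := ν.submul' 0 0
    have hp := ν.pos' 0
    simp only [add_zero] at h
    nlinarith
  have h := ν.submul' x (-x)
  rw [← ν.symm' x, add_neg_cancel] at h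
  have hp := ν.pos' x
  nlinarith

theorem SubmulSymmWeight.one_le_latticeVal (ν : SubmulSymmWeight d) (l : IntLattice d) : 1 ≤ ν.latticeVal l := by
  unfold SubmulSymmWeight.latticeVal
  rw [← ENNReal.ofReal_one]
  exact ENNReal.ofReal_le_ofReal (ν.one_le _)

theorem SubmulSymmWeight.latticeVal_add_le (ν : SubmulSymmWeight d) (l m : IntLattice d) :
    ν.latticeVal (l + m) ≤ ν.latticeVal l * ν.latticeVal m := by
  unfold SubmulSymmWeight.latticeVal
  rw [← ENNReal.ofReal_mul (ν.pos' _).le]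
  apply ENNReal.ofReal_le_ofReal
  have : latticePoint (l + m) = latticePoint l + latticePoint m := by
    ext i; simp [latticePoint]
  rw [this]
  exact ν.submul' _ _

theorem SubmulSymmWeight.latticeVal_neg (ν : SubmulSymmWeight d) (l : IntLattice d) :
    ν.latticeVal (-l) = ν.latticeVal l := by
  unfold SubmulSymmWeight.latticeVal
  have : latticePoint (-l) = - latticePoint l := by
    ext i; simp [latticePoint]
  rw [this, ← ν.symm']

theorem le_sideDiag (A : OpMatrix d H) (k l : IntLattice d) : ‖A k l‖ₑ ≤ sideDiag A (k - l) := by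
  have := le_iSup (fun j : IntLattice d => ‖A j (j - (k - l))‖ₑ) k
  simp only [sub_sub_cancel] at this
  exact this

theorem sideDiag_le_enorm (ν : SubmulSymmWeight d) (A : OpMatrix d H) (l : IntLattice d) :
    sideDiag A l ≤ bgsENorm ν A :=
  (le_mul_of_one_le_right' (ν.one_le_latticeVal l)).trans
    (ENNReal.le_tsum (f := fun l => sideDiag A l * ν.latticeVal l) l)

theorem entry_le_enorm (ν : SubmulSymmWeight d) (A : OpMatrix d H) (k l : IntLattice d) :
    ‖A k l‖ₑ ≤ bgsENorm ν A :=
  (le_sideDiag A k l).trans (sideDiag_le_enorm ν A _)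

theorem tsum_sideDiag_le (ν : SubmulSymmWeight d) (A : OpMatrix d H) :
    ∑' l, sideDiag A l ≤ bgsENorm ν A :=
  ENNReal.tsum_le_tsum fun l => le_mul_of_one_le_right' (ν.one_le_latticeVal l)

theorem bgsENorm_zero (ν : SubmulSymmWeight d) : bgsENorm ν (0 : OpMatrix d H) = 0 := by
  simp [bgsENorm, sideDiag, enorm_eq_nnnorm]

theorem bgsENorm_add (ν : SubmulSymmWeight d) (A B : OpMatrix d H) :
    bgsENorm ν (A + B) ≤ bgsENorm ν A + bgsENorm ν B := by
  unfold bgsENorm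
  rw [← ENNReal.tsum_add]
  refine ENNReal.tsum_le_tsum fun l => ?_
  rw [← add_mul]
  gcongr
  refine iSup_le fun k => (enorm_add_le (A k (k - l)) (B k (k - l))).trans ?_
  exact add_le_add (le_iSup (fun k => ‖A k (k - l)‖ₑ) k) (le_iSup (fun k => ‖B k (k - l)‖ₑ) k)

theorem bgsENorm_smul (ν : SubmulSymmWeight d) (c : ℂ) (A : OpMatrix d H) :
    bgsENorm ν (c • A) = ‖c‖ₑ * bgsENorm ν A := by
  unfold bgsENorm sideDiag
  rw [← ENNReal.tsum_mul_left]
  refine tsum_congr fun l => ?_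
  simp only [Pi.smul_apply, enorm_smul]
  rw [← ENNReal.mul_iSup, mul_assoc]

theorem bgsENorm_neg (ν : SubmulSymmWeight d) (A : OpMatrix d H) :
    bgsENorm ν (-A) = bgsENorm ν A := by
  simp [bgsENorm, sideDiag]

theorem bgsENorm_one (ν : SubmulSymmWeight d) : bgsENorm ν (matOne d H) < ⊤ := by
  unfold bgsENorm
  rw [tsum_eq_single 0]
  · refine ENNReal.mul_lt_top ?_ ENNReal.ofReal_lt_top
    simp only [sideDiag, matOne, sub_zero, if_true]
    exact lt_of_le_of_lt (iSup_le fun _ => le_rfl) (enorm_lt_top (x := (1 : H →L[ℂ] H)))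
  · intro l hl
    have : sideDiag (matOne d H) l = 0 := by
      have hk : ∀ k : IntLattice d, k ≠ k - l := fun k h => hl (by simpa using h.symm)
      simp [sideDiag, matOne, hk, enorm_eq_nnnorm]
    simp [this]

theorem enorm_tsum_le_of {ι E : Type*} [NormedAddCommGroup E] (f : ι → E) :
    ‖∑' i, f i‖ₑ ≤ ∑' i, ‖f i‖ₑ := by
  by_cases h : (∑' i, ‖f i‖ₑ) = ⊤
  · rw [h]; exact le_top
  · have hs : Summable fun i => ‖f i‖ := by
      have := ENNReal.summable_toReal h
      simpa using this
    have h1 := norm_tsum_le_tsum_norm hs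
    have h2 := ENNReal.ofReal_le_ofReal h1
    rw [ofReal_norm, ENNReal.ofReal_tsum_of_nonneg (fun _ => norm_nonneg _) hs] at h2
    simpa [ofReal_norm] using h2

theorem bgsENorm_mul (ν : SubmulSymmWeight d) (A B : OpMatrix d H) :
    bgsENorm ν (matMul A B) ≤ bgsENorm ν A * bgsENorm ν B := by
  have key : ∀ l, sideDiag (matMul A B) l ≤ ∑' m, sideDiag A m * sideDiag B (l - m) := by
    intro l
    refine iSup_le fun k => ?_
    calc ‖matMul A B k (k - l)‖ₑ ≤ ∑' n, ‖A k n * B n (k - l)‖ₑ := enorm_tsum_le_of _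
      _ ≤ ∑' n, sideDiag A (k - n) * sideDiag B (l - (k - n)) := by
          refine ENNReal.tsum_le_tsum fun n => ?_
          have h1 : ‖A k n * B n (k - l)‖ₑ ≤ ‖A k n‖ₑ * ‖B n (k - l)‖ₑ := by
            rw [enorm_eq_nnnorm, enorm_eq_nnnorm, enorm_eq_nnnorm]
            exact_mod_cast nnnorm_mul_le (A k n) (B n (k - l))
          refine h1.trans (mul_le_mul' (le_sideDiag A k n) ?_)
          have := le_sideDiag B n (k - l)
          rwa [show n - (k - l) = l - (k - n) by abel] at this
      _ = ∑' m, sideDiag A m * sideDiag B (l - m) :=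
          (Equiv.subLeft k).tsum_eq (fun m => sideDiag A m * sideDiag B (l - m))
  calc bgsENorm ν (matMul A B)
      ≤ ∑' l, ∑' m, (sideDiag A m * ν.latticeVal m) * (sideDiag B (l - m) * ν.latticeVal (l - m)) := by
        refine ENNReal.tsum_le_tsum fun l => ?_
        refine (mul_le_mul_left (key l) _).trans ?_
        rw [← ENNReal.tsum_mul_right]
        refine ENNReal.tsum_le_tsum fun m => ?_
        have h := ν.latticeVal_add_le m (l - m)
        rw [add_sub_cancel] at h
        calc _ ≤ sideDiag A m * sideDiag B (l - m) * (ν.latticeVal m * ν.latticeVal (l - m)) := by gcongr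
          _ = _ := by ring
    _ = ∑' m, ∑' l, (sideDiag A m * ν.latticeVal m) * (sideDiag B (l - m) * ν.latticeVal (l - m)) :=
        ENNReal.tsum_comm
    _ = ∑' m, (sideDiag A m * ν.latticeVal m) * bgsENorm ν B := by
        refine tsum_congr fun m => ?_
        rw [ENNReal.tsum_mul_left]
        congr 1
        exact (Equiv.subRight m).tsum_eq (fun l => sideDiag B l * ν.latticeVal l)
    _ = bgsENorm ν A * bgsENorm ν B := ENNReal.tsum_mul_right

theorem bgsENorm_star [CompleteSpace H] (ν : SubmulSymmWeight d) (A : OpMatrix d H) :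
    bgsENorm ν (matStar A) = bgsENorm ν A := by
  have key : ∀ l, sideDiag (matStar A) l = sideDiag A (-l) := by
    intro l
    unfold sideDiag matStar
    rw [← (Equiv.subRight l).iSup_comp (g := fun k => ‖A k (k - -l)‖ₑ)]
    refine iSup_congr fun k => ?_
    simp [enorm_eq_nnnorm]
  unfold bgsENorm
  rw [← (Equiv.neg (IntLattice d)).tsum_eq (fun l => sideDiag A l * ν.latticeVal l)]
  refine tsum_congr fun l => ?_
  simp [key, ν.latticeVal_neg]

end Basic

section Operator

variable {d : ℕ} {H : Type*} [NormedAddCommGroup H] [InnerProductSpace ℂ H]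

/-- A bounded operator is determined by its matrix. -/
theorem IsMatrixOf.unique {A : OpMatrix d H} {S T : SeqL2 d H →L[ℂ] SeqL2 d H}
    (hS : IsMatrixOf A S) (hT : IsMatrixOf A T) : S = T := by
  ext f k
  exact (hS f k).unique (hT f k)

theorem IsMatrixOf.apply_single {A : OpMatrix d H} {T : SeqL2 d H →L[ℂ] SeqL2 d H}
    (hT : IsMatrixOf A T) (k l : IntLattice d) (h : H) :
    T (lp.single 2 l h) k = A k l h := by
  refine (hT _ k).unique ?_
  have := hasSum_single (f := fun m => A k m ((lp.single 2 l h : SeqL2 d H) m)) l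
    (fun m hm => by simp [lp.single_apply, hm])
  simpa [lp.single_apply] using this

/-- Evaluation of a sequence at an index, as a continuous linear map. -/
def evalCLM (k : IntLattice d) : SeqL2 d H →L[ℂ] H :=
  LinearMap.mkContinuous
    { toFun := fun f => f k, map_add' := fun _ _ => rfl, map_smul' := fun _ _ => rfl } 1
    (fun f => by
      rw [one_mul]
      exact lp.norm_apply_le_norm (p := 2) (by norm_num) f k)

/-- The matrix of a bounded operator is determined by its action on one-term sequences. -/
theorem isMatrixOf_of_single {A : OpMatrix d H} {T : SeqL2 d H →L[ℂ] SeqL2 d H}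
    (h : ∀ k l x, T (lp.single 2 l x) k = A k l x) : IsMatrixOf A T := by
  intro f k
  have h1 := lp.hasSum_single (p := 2) (by norm_num) f
  have h2 := ((evalCLM k).comp T).hasSum h1
  have h3 : (fun l => A k l (f l)) =
      fun l => ((evalCLM k).comp T) (lp.single 2 l (f l)) := by
    funext l
    exact (h k l (f l)).symm
  rw [h3]
  exact h2

theorem summable_norm_of_tsum_enorm {ι E : Type*} [NormedAddCommGroup E] {f : ι → E}
    {g : ι → ℝ≥0∞} (hfg : ∀ i, ‖f i‖ₑ ≤ g i) (h : ∑' i, g i ≠ ⊤) : Summable fun i => ‖f i‖ := by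
  have h' : (∑' i, ‖f i‖ₑ) ≠ ⊤ := ne_top_of_le_ne_top h (ENNReal.tsum_le_tsum hfg)
  simpa using ENNReal.summable_toReal h'

/-- The operator of a side diagonal: `(D f)_k = a_k f_{k-l}`. -/
theorem exists_diag (a : IntLattice d → (H →L[ℂ] H)) (l : IntLattice d) (C : ℝ) (hC : 0 ≤ C)
    (ha : ∀ k, ‖a k‖ ≤ C) :
    ∃ D : SeqL2 d H →L[ℂ] SeqL2 d H, ‖D‖ ≤ C ∧ ∀ f k, D f k = a k (f (k - l)) := by
  have hsum : ∀ f : SeqL2 d H, Summable fun k => ‖f (k - l)‖ ^ (2 : ℝ≥0∞).toReal := fun f =>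
    ((Equiv.subRight l).summable_iff (f := fun k => ‖f k‖ ^ (2 : ℝ≥0∞).toReal)).2
      ((lp.memℓp f).summable (by norm_num))
  have hle : ∀ (f : SeqL2 d H) k, ‖a k (f (k - l))‖ ^ (2 : ℝ≥0∞).toReal ≤
      C ^ (2 : ℝ≥0∞).toReal * ‖f (k - l)‖ ^ (2 : ℝ≥0∞).toReal := by
    intro f k
    rw [← Real.mul_rpow hC (norm_nonneg _)]
    exact Real.rpow_le_rpow (norm_nonneg _)
      ((a k).le_of_opNorm_le (ha k) _) (by norm_num)
  have hmem : ∀ f : SeqL2 d H, Memℓp (fun k => a k (f (k - l))) 2 := fun f =>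
    memℓp_gen (Summable.of_nonneg_of_le (fun k => by positivity) (hle f) ((hsum f).mul_left _))
  let L : SeqL2 d H →ₗ[ℂ] SeqL2 d H :=
    { toFun := fun f => ⟨fun k => a k (f (k - l)), hmem f⟩
      map_add' := fun f g => by ext k; exact (a k).map_add _ _
      map_smul' := fun c f => by ext k; simp }
  refine ⟨L.mkContinuous C fun f => ?_, LinearMap.mkContinuous_norm_le _ hC _, fun f k => rfl⟩
  have h2 : 0 < (2 : ℝ≥0∞).toReal := by norm_num
  refine lp.norm_le_of_tsum_le h2 (by positivity) ?_
  rw [Real.mul_rpow hC (norm_nonneg _), lp.norm_rpow_eq_tsum h2]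
  rw [← (Equiv.subRight l).tsum_eq (fun k => ‖f k‖ ^ (2 : ℝ≥0∞).toReal), ← tsum_mul_left]
  exact (Summable.of_nonneg_of_le (fun k => by positivity) (hle f)
    ((hsum f).mul_left _)).tsum_le_tsum (hle f) ((hsum f).mul_left _)

/-- A matrix of finite weighted norm defines a bounded operator on `ℓ²(ℤᵈ; H)`. -/
theorem exists_isMatrixOf [CompleteSpace H] (ν : SubmulSymmWeight d) (A : OpMatrix d H)
    (hA : bgsENorm ν A < ⊤) : ∃ T : SeqL2 d H →L[ℂ] SeqL2 d H, IsMatrixOf A T := by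
  have hfin : ∀ l, sideDiag A l ≠ ⊤ := fun l => ((sideDiag_le_enorm ν A l).trans_lt hA).ne
  have hs : Summable fun l => (sideDiag A l).toReal :=
    ENNReal.summable_toReal ((tsum_sideDiag_le ν A).trans_lt hA).ne
  have hbd : ∀ l k, ‖A k (k - l)‖ ≤ (sideDiag A l).toReal := by
    intro l k
    have h1 : ‖A k (k - l)‖ₑ ≤ sideDiag A l := le_iSup (fun k => ‖A k (k - l)‖ₑ) k
    simpa using ENNReal.toReal_mono (hfin l) h1
  choose D hD hDa using fun l => exists_diag (fun k => A k (k - l)) l _ ENNReal.toReal_nonneg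
    (hbd l)
  have hsD : Summable D := Summable.of_norm_bounded hs hD
  refine ⟨∑' l, D l, fun f k => ?_⟩
  have h1 := ((evalCLM (H := H) k).comp
    (ContinuousLinearMap.apply ℂ (SeqL2 d H) f)).hasSum hsD.hasSum
  have h2 : HasSum (fun l => A k (k - l) (f (k - l))) ((∑' l, D l) f k) := by
    refine h1.congr_fun ?_
    intro l
    exact (hDa l f k).symm
  have h3 := (Equiv.subLeft k).hasSum_iff.2 h2
  refine h3.congr_fun ?_
  intro l
  simp
theorem isMatrixOf_one : IsMatrixOf (matOne d H) (1 : SeqL2 d H →L[ℂ] SeqL2 d H) := by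
  refine isMatrixOf_of_single fun k l x => ?_
  by_cases h : k = l
  · subst h; simp [matOne, lp.single_apply]
  · simp [matOne, lp.single_apply, h]

/-- For matrices of finite weighted norm, the series defining the entries of the product converge
absolutely in `B(H)`. -/
theorem summable_matMul (ν : SubmulSymmWeight d) {A B : OpMatrix d H} (hA : bgsENorm ν A < ⊤)
    (hB : bgsENorm ν B < ⊤) (k l : IntLattice d) : Summable fun n => ‖A k n * B n l‖ := by
  refine summable_norm_of_tsum_enorm (g := fun n => sideDiag A (k - n) * bgsENorm ν B) ?_ ?_
  · intro n
    have h1 : ‖A k n * B n l‖ₑ ≤ ‖A k n‖ₑ * ‖B n l‖ₑ := by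
      rw [enorm_eq_nnnorm, enorm_eq_nnnorm, enorm_eq_nnnorm]
      exact_mod_cast nnnorm_mul_le (A k n) (B n l)
    exact h1.trans (mul_le_mul' (le_sideDiag A k n) (entry_le_enorm ν B n l))
  · have h1 : ∑' n, sideDiag A (k - n) = ∑' m, sideDiag A m :=
      (Equiv.subLeft k).tsum_eq (fun m => sideDiag A m)
    rw [ENNReal.tsum_mul_right, h1]
    exact (ENNReal.mul_lt_top ((tsum_sideDiag_le ν A).trans_lt hA) hB).ne

theorem IsMatrixOf.mul [CompleteSpace H] (ν : SubmulSymmWeight d) {A B : OpMatrix d H}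
    (hA : bgsENorm ν A < ⊤) (hB : bgsENorm ν B < ⊤) {S T : SeqL2 d H →L[ℂ] SeqL2 d H}
    (hS : IsMatrixOf A S) (hT : IsMatrixOf B T) : IsMatrixOf (matMul A B) (S * T) := by
  refine isMatrixOf_of_single fun k l x => ?_
  have h1 := hS (T (lp.single 2 l x)) k
  have h2 := (ContinuousLinearMap.apply ℂ H x).hasSum
    (summable_matMul ν hA hB k l).of_norm.hasSum
  refine h1.unique (h2.congr_fun ?_)
  intro n
  simp [hT.apply_single]

theorem IsMatrixOf.star [CompleteSpace H] {A : OpMatrix d H} {T : SeqL2 d H →L[ℂ] SeqL2 d H}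
    (hT : IsMatrixOf A T) : IsMatrixOf (matStar A) (star T) := by
  refine isMatrixOf_of_single fun k l x => ?_
  refine ext_inner_right ℂ fun y => ?_
  rw [← lp.inner_single_right, ContinuousLinearMap.star_eq_adjoint,
    ContinuousLinearMap.adjoint_inner_left, lp.inner_single_left, hT.apply_single]
  simp only [matStar]
  rw [ContinuousLinearMap.star_eq_adjoint, ContinuousLinearMap.adjoint_inner_left]

end Operator

section Algebra

variable {d : ℕ}

/-- The matrices of finite weighted norm, as a linear subspace of all matrices. -/
def bgsSubmodule (ν : SubmulSymmWeight d) (H : Type*) [NormedAddCommGroup H]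
    [InnerProductSpace ℂ H] : Submodule ℂ (OpMatrix d H) where
  carrier := {A | bgsENorm ν A < ⊤}
  add_mem' := fun hA hB => (bgsENorm_add ν _ _).trans_lt (ENNReal.add_lt_top.2 ⟨hA, hB⟩)
  zero_mem' := by
    change bgsENorm ν (0 : OpMatrix d H) < ⊤
    rw [bgsENorm_zero]; exact ENNReal.zero_lt_top
  smul_mem' := fun c A hA => by
    change bgsENorm ν (c • A) < ⊤
    rw [bgsENorm_smul]
    exact ENNReal.mul_lt_top enorm_lt_top hA

/-- The weighted Baskakov-Gohberg-Sjöstrand algebra `C_ν`: all `B(H)`-valued matrices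
`A = [A_{k,l}]` indexed by `ℤᵈ` such that `∑_l sup_k ‖A_{k,k-l}‖ ν l < ∞`. -/
def BGS (ν : SubmulSymmWeight d) (H : Type*) [NormedAddCommGroup H] [InnerProductSpace ℂ H] :
    Type _ := bgsSubmodule ν H

namespace BGS

variable {ν : SubmulSymmWeight d} {H : Type*} [NormedAddCommGroup H] [InnerProductSpace ℂ H]

/-- The entries of a matrix in `C_ν`. -/
def entry (A : BGS ν H) : OpMatrix d H := A.1

theorem enorm_lt (A : BGS ν H) : bgsENorm ν A.entry < ⊤ := A.2

/-- A matrix of finite weighted norm, as an element of `C_ν`. -/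
def mk (A : OpMatrix d H) (hA : bgsENorm ν A < ⊤) : BGS ν H := ⟨A, hA⟩

@[ext] theorem ext {A B : BGS ν H} (h : A.entry = B.entry) : A = B := Subtype.ext h

instance : AddCommGroup (BGS ν H) := inferInstanceAs (AddCommGroup (bgsSubmodule ν H))
instance : Module ℂ (BGS ν H) := inferInstanceAs (Module ℂ (bgsSubmodule ν H))

@[simp] theorem entry_mk (A : OpMatrix d H) (hA : bgsENorm ν A < ⊤) : (mk A hA).entry = A := rfl
@[simp] theorem entry_zero : (0 : BGS ν H).entry = 0 := rfl
@[simp] theorem entry_add (A B : BGS ν H) : (A + B).entry = A.entry + B.entry := rfl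
@[simp] theorem entry_neg (A : BGS ν H) : (-A).entry = -A.entry := rfl
@[simp] theorem entry_sub (A B : BGS ν H) : (A - B).entry = A.entry - B.entry := rfl
@[simp] theorem entry_smul (c : ℂ) (A : BGS ν H) : (c • A).entry = c • A.entry := rfl

/-- The norm `‖A‖ = ∑_l sup_k ‖A_{k,k-l}‖ ν l` of `C_ν`. -/
instance : NormedAddCommGroup (BGS ν H) :=
  AddGroupNorm.toNormedAddCommGroup
    { toFun := fun A => (bgsENorm ν A.entry).toReal
      map_zero' := by simp [bgsENorm_zero]
      add_le' := fun A B => by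
        rw [← ENNReal.toReal_add A.enorm_lt.ne B.enorm_lt.ne]
        exact ENNReal.toReal_mono (ENNReal.add_lt_top.2 ⟨A.enorm_lt, B.enorm_lt⟩).ne
          (bgsENorm_add ν _ _)
      neg' := fun A => by simp [bgsENorm_neg]
      eq_zero_of_map_eq_zero' := fun A hA => by
        have h0 : bgsENorm ν A.entry = 0 :=
          ((ENNReal.toReal_eq_zero_iff _).1 hA).resolve_right A.enorm_lt.ne
        ext1
        funext k l
        have h1 := entry_le_enorm ν A.entry k l
        rw [h0, enorm_eq_nnnorm] at h1
        simpa using h1 }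

theorem norm_def (A : BGS ν H) : ‖A‖ = (bgsENorm ν A.entry).toReal := rfl

instance : NormedSpace ℂ (BGS ν H) where
  norm_smul_le c A := by
    simp [norm_def, bgsENorm_smul, ENNReal.toReal_mul]

theorem norm_entry_le (A : BGS ν H) (k l : IntLattice d) : ‖A.entry k l‖ ≤ ‖A‖ := by
  have := ENNReal.toReal_mono A.enorm_lt.ne (entry_le_enorm ν A.entry k l)
  rw [toReal_enorm] at this
  exact this

theorem lowerSemicontinuous_bgsENorm (ν : SubmulSymmWeight d) :
    LowerSemicontinuous (bgsENorm ν : OpMatrix d H → ℝ≥0∞) := by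
  unfold bgsENorm
  refine lowerSemicontinuous_tsum fun l => ?_
  have : (fun A : OpMatrix d H => sideDiag A l * ν.latticeVal l) =
      fun A => ⨆ k : IntLattice d, ‖A k (k - l)‖ₑ * ν.latticeVal l := by
    funext A
    rw [sideDiag, ENNReal.iSup_mul]
  rw [this]
  refine lowerSemicontinuous_iSup fun k => Continuous.lowerSemicontinuous ?_
  refine (ENNReal.continuous_mul_const ENNReal.ofReal_ne_top).comp ?_
  have h : Continuous fun A : OpMatrix d H => A k (k - l) :=
    (continuous_apply (k - l)).comp (continuous_apply k)
  exact ENNReal.continuous_coe.comp (continuous_nnnorm.comp h)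

instance [CompleteSpace H] : CompleteSpace (BGS ν H) := by
  refine Metric.complete_of_cauchySeq_tendsto fun u hu => ?_
  have hc : ∀ k l, CauchySeq fun n => (u n).entry k l := by
    intro k l
    rw [Metric.cauchySeq_iff'] at hu ⊢
    intro ε hε
    obtain ⟨N, hN⟩ := hu ε hε
    refine ⟨N, fun n hn => ?_⟩
    have := hN n hn
    rw [dist_eq_norm] at this ⊢
    exact (norm_entry_le (u n - u N) k l).trans_lt this
  choose B hB using fun k l => cauchySeq_tendsto_of_complete (hc k l)
  have hlim : Filter.Tendsto (fun n => (u n).entry) Filter.atTop (nhds (B : OpMatrix d H)) :=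
    tendsto_pi_nhds.2 fun k => tendsto_pi_nhds.2 fun l => hB k l
  have key : ∀ ε > 0, ∃ N, ∀ n ≥ N, bgsENorm ν (B - (u n).entry) ≤ ENNReal.ofReal ε := by
    intro ε hε
    obtain ⟨N, hN⟩ := Metric.cauchySeq_iff.1 hu ε hε
    refine ⟨N, fun n hn => ?_⟩
    have hcl := (lowerSemicontinuous_bgsENorm (H := H) ν).isClosed_preimage (ENNReal.ofReal ε)
    refine hcl.mem_of_tendsto (hlim.sub_const _) (Filter.eventually_atTop.2 ⟨N, fun m hm => ?_⟩)
    have h := hN m hm n hn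
    rw [dist_eq_norm, norm_def] at h
    exact (ENNReal.le_ofReal_iff_toReal_le (u m - u n).enorm_lt.ne hε.le).2 h.le
  obtain ⟨N, hN⟩ := key 1 one_pos
  have hBfin : bgsENorm ν B < ⊤ := by
    have h1 := bgsENorm_add ν (B - (u N).entry) (u N).entry
    rw [sub_add_cancel] at h1
    exact h1.trans_lt (ENNReal.add_lt_top.2
      ⟨(hN N le_rfl).trans_lt ENNReal.ofReal_lt_top, (u N).enorm_lt⟩)
  refine ⟨mk B hBfin, ?_⟩
  rw [Metric.tendsto_atTop]
  intro ε hε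
  obtain ⟨M, hM⟩ := key (ε / 2) (half_pos hε)
  refine ⟨M, fun n hn => ?_⟩
  rw [dist_comm, dist_eq_norm, norm_def]
  have h2 : bgsENorm ν (mk B hBfin - u n).entry ≤ ENNReal.ofReal (ε / 2) := hM n hn
  have h3 := ENNReal.toReal_mono ENNReal.ofReal_ne_top h2
  rw [ENNReal.toReal_ofReal (half_pos hε).le] at h3
  linarith

instance : One (BGS ν H) := ⟨mk (matOne d H) (bgsENorm_one ν)⟩

/-- Matrix multiplication on `C_ν`. -/
instance : Mul (BGS ν H) :=
  ⟨fun A B => mk (matMul A.entry B.entry)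
    ((bgsENorm_mul ν _ _).trans_lt (ENNReal.mul_lt_top A.enorm_lt B.enorm_lt))⟩

@[simp] theorem entry_one : (1 : BGS ν H).entry = matOne d H := rfl
@[simp] theorem entry_mul (A B : BGS ν H) : (A * B).entry = matMul A.entry B.entry := rfl

variable [CompleteSpace H]

/-- The involution `A ↦ A^*` of `C_ν`. -/
instance : Star (BGS ν H) :=
  ⟨fun A => mk (matStar A.entry) (by rw [bgsENorm_star]; exact A.enorm_lt)⟩

@[simp] theorem entry_star (A : BGS ν H) : (star A).entry = matStar A.entry := rfl

/-- The bounded operator on `ℓ²(ℤᵈ; H)` given by a matrix in `C_ν`; it is unique. -/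
def toOp (A : BGS ν H) : SeqL2 d H →L[ℂ] SeqL2 d H :=
  (exists_isMatrixOf ν A.entry A.enorm_lt).choose

theorem isMatrixOf_toOp (A : BGS ν H) : IsMatrixOf A.entry A.toOp :=
  (exists_isMatrixOf ν A.entry A.enorm_lt).choose_spec

theorem toOp_eq {A : BGS ν H} {T : SeqL2 d H →L[ℂ] SeqL2 d H} (h : IsMatrixOf A.entry T) :
    A.toOp = T := A.isMatrixOf_toOp.unique h

theorem toOp_injective : Function.Injective (toOp : BGS ν H → _) := by
  intro A B h
  ext1
  funext k l
  ext x
  rw [← A.isMatrixOf_toOp.apply_single, h, B.isMatrixOf_toOp.apply_single]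

theorem toOp_add (A B : BGS ν H) : (A + B).toOp = A.toOp + B.toOp :=
  toOp_eq fun f k => (A.isMatrixOf_toOp f k).add (B.isMatrixOf_toOp f k)

theorem toOp_zero : (0 : BGS ν H).toOp = 0 :=
  toOp_eq fun _ _ => hasSum_zero

theorem toOp_smul (c : ℂ) (A : BGS ν H) : (c • A).toOp = c • A.toOp :=
  toOp_eq fun f k => (A.isMatrixOf_toOp f k).const_smul c

theorem toOp_one : (1 : BGS ν H).toOp = 1 := toOp_eq isMatrixOf_one

theorem toOp_mul (A B : BGS ν H) : (A * B).toOp = A.toOp * B.toOp :=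
  toOp_eq (IsMatrixOf.mul ν A.enorm_lt B.enorm_lt A.isMatrixOf_toOp B.isMatrixOf_toOp)

theorem toOp_star (A : BGS ν H) : (star A).toOp = star A.toOp :=
  toOp_eq A.isMatrixOf_toOp.star

instance : Ring (BGS ν H) :=
  { (inferInstance : AddCommGroup (BGS ν H)), (inferInstance : Mul (BGS ν H)),
    (inferInstance : One (BGS ν H)) with
    left_distrib := fun A B C => toOp_injective (by simp only [toOp_mul, toOp_add, mul_add])
    right_distrib := fun A B C => toOp_injective (by simp only [toOp_mul, toOp_add, add_mul])
    zero_mul := fun A => toOp_injective (by simp only [toOp_mul, toOp_zero, zero_mul])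
    mul_zero := fun A => toOp_injective (by simp only [toOp_mul, toOp_zero, mul_zero])
    mul_assoc := fun A B C => toOp_injective (by simp only [toOp_mul, mul_assoc])
    one_mul := fun A => toOp_injective (by simp only [toOp_mul, toOp_one, one_mul])
    mul_one := fun A => toOp_injective (by simp only [toOp_mul, toOp_one, mul_one]) }

instance : NormedRing (BGS ν H) :=
  { (inferInstance : NormedAddCommGroup (BGS ν H)), (inferInstance : Ring (BGS ν H)) with
    norm_mul_le := fun A B => by
      simp only [norm_def, entry_mul]
      rw [← ENNReal.toReal_mul]
      exact ENNReal.toReal_mono (ENNReal.mul_lt_top A.enorm_lt B.enorm_lt).ne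
        (bgsENorm_mul ν _ _) }

instance : Algebra ℂ (BGS ν H) :=
  Algebra.ofModule
    (fun c A B => toOp_injective (by simp only [toOp_mul, toOp_smul, smul_mul_assoc]))
    (fun c A B => toOp_injective (by simp only [toOp_mul, toOp_smul, mul_smul_comm]))

instance : NormedAlgebra ℂ (BGS ν H) where
  norm_smul_le := norm_smul_le

instance : StarRing (BGS ν H) where
  star_involutive A := toOp_injective (by simp only [toOp_star, star_star])
  star_mul A B := toOp_injective (by simp only [toOp_mul, toOp_star, star_mul])
  star_add A B := toOp_injective (by simp only [toOp_add, toOp_star, star_add])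

instance : StarModule ℂ (BGS ν H) where
  star_smul c A := toOp_injective (by simp only [toOp_smul, toOp_star, star_smul])

instance : NormedStarGroup (BGS ν H) where
  norm_star_le A := by
    simp only [norm_def, entry_star, bgsENorm_star]
    exact le_rfl

/-- The inclusion `C_ν ⊆ B(ℓ²(ℤᵈ; H))`: a matrix is sent to the operator it defines. -/
def inclusion (ν : SubmulSymmWeight d) (H : Type*) [NormedAddCommGroup H]
    [InnerProductSpace ℂ H] [CompleteSpace H] :
    BGS ν H →⋆ₐ[ℂ] (SeqL2 d H →L[ℂ] SeqL2 d H) where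
  toFun := toOp
  map_one' := toOp_one
  map_mul' := toOp_mul
  map_zero' := toOp_zero
  map_add' := toOp_add
  commutes' c := by
    rw [Algebra.algebraMap_eq_smul_one, toOp_smul, toOp_one, Algebra.algebraMap_eq_smul_one]
  map_star' := toOp_star

end BGS

/-- Let `𝒜 ⊆ ℬ` be unital Banach *-algebras with common identity, the inclusion being the
injective unital *-homomorphism `ι`. They form a Wiener pair if `𝒜` is inverse-closed in `ℬ`:
whenever `a ∈ 𝒜` has an inverse `b` in `ℬ`, then `b ∈ 𝒜`. -/
structure IsWienerPair {𝒜 ℬ : Type*}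
    [NormedRing 𝒜] [NormedAlgebra ℂ 𝒜] [CompleteSpace 𝒜]
    [StarRing 𝒜] [StarModule ℂ 𝒜] [NormedStarGroup 𝒜]
    [NormedRing ℬ] [NormedAlgebra ℂ ℬ] [CompleteSpace ℬ]
    [StarRing ℬ] [StarModule ℂ ℬ] [NormedStarGroup ℬ]
    (ι : 𝒜 →⋆ₐ[ℂ] ℬ) : Prop where
  injective : Function.Injective ι
  inverse_closed : ∀ (a : 𝒜) (b : ℬ), ι a * b = 1 → b * ι a = 1 → ∃ c : 𝒜, ι c = b

/-- A unital Banach *-algebra `𝒜` is symmetric if the spectrum in `𝒜` of `a^* a` is contained in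
`[0, ∞)` for every `a`. -/
def IsSymmetricBanachAlgebra (𝒜 : Type*) [NormedRing 𝒜] [NormedAlgebra ℂ 𝒜] [CompleteSpace 𝒜]
    [StarRing 𝒜] [StarModule ℂ 𝒜] [NormedStarGroup 𝒜] : Prop :=
  ∀ a : 𝒜, spectrum ℂ (star a * a) ⊆ Complex.ofReal '' Set.Ici (0 : ℝ)

end Algebra

end

/-! Write `A` as the sum of its side diagonals `D l`, viewed as operators on `ℓ²(ℤᵈ; H)`. For a
unitary character `χ` of `ℤᵈ`, the sum `∑ χ(l) D l` is `A` conjugated by the modulation `f ↦ χ f`.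
Left invertibility of `A` therefore gives left invertibility of every value of this operator-valued
Fourier series (`exists_left_inverse_modulated`), and the noncommutative Wiener lemma applies to the
series.

That lemma (`exists_left_inverse_tsum`) follows Bochner and Phillips. If `F = ∑ D l * u l` has no
left inverse, it lies in a maximal left ideal `L`. The central elements `u l` are scalars `χ l`
modulo `L`, by a Schur argument (`exists_sub_algebraMap_mem_of_central`). The GRS condition forces
`|χ l| = 1`, so `F` is congruent modulo `L` to the left invertible element `∑ χ(l) D l`, which is
absurd.

The lemma is applied to Laurent matrices with entries in `B(ℓ²(ℤᵈ; H))`, inside the centralizer of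
the translations, where the translations `u l` are central (`exists_left_inverse_laurent`). The
block `(k, j)` of the entry `(k, j)` of the left inverse `G` then gives a matrix in `C_ν` that is a
left inverse of `A` (`exists_left_inverse`). When `A` is invertible on `ℓ²`, this left inverse is
the inverse. Symmetry follows from spectral invariance and positivity of `T^* T` in a C*-algebra. -/

/-! ### Maximal left ideals and the Bochner–Phillips form of Wiener's lemma -/

/-- Schur's lemma combined with Gelfand–Mazur: `W ⧸ L` is a simple left module, so a central element
outside `L` acts bijectively on it. Multiplication by `z` is a bounded operator on this Banach space
and has a spectral value `c`; hence `c - z` must lie in `L`. -/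
theorem exists_sub_algebraMap_mem_of_central {W : Type*} [NormedRing W] [NormedAlgebra ℂ W]
    [CompleteSpace W] (L : Ideal W) [hL : L.IsMaximal] (z : W) (hz : ∀ x, z * x = x * z) :
    ∃ c : ℂ, z - algebraMap ℂ W c ∈ L := by
  by_contra! hne
  have hcl : IsClosed (L : Set W) := by
    rw [← hL.closure_eq]; exact isClosed_closure
  let S : Submodule ℂ W := L.restrictScalars ℂ
  have hS : IsClosed (S : Set W) := hcl
  have hSmem : ∀ x, x ∈ S ↔ x ∈ L := fun x => Iff.rfl
  have : IsClosed (S : Set W) := hS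
  have hStop : S ≠ ⊤ := fun h => hL.ne_top (by
    rw [Ideal.eq_top_iff_one, ← hSmem, h]; trivial)
  have : Nontrivial (W ⧸ S) := Submodule.Quotient.nontrivial_iff.2 hStop
  let T : (W ⧸ S) →L[ℂ] (W ⧸ S) :=
    ⟨S.mapQ S (LinearMap.mulLeft ℂ z) (fun x hx => L.mul_mem_left z hx),
      continuous_quot_lift _ (continuous_quot_mk.comp (continuous_const_mul z))⟩
  have hT : ∀ x : W, T (S.mkQ x) = S.mkQ (z * x) := fun x => rfl
  obtain ⟨c, hc⟩ := spectrum.nonempty T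
  refine hc ?_
  have hap : ∀ x : W, (algebraMap ℂ _ c - T) (S.mkQ x) = S.mkQ ((algebraMap ℂ W c - z) * x) := by
    intro x
    rw [sub_apply, hT, sub_mul, map_sub, Algebra.algebraMap_eq_smul_one,
      Algebra.algebraMap_eq_smul_one, smul_mul_assoc, one_mul, map_smul]
    rfl
  set w := algebraMap ℂ W c - z with hw
  have hwL : w ∉ L := fun h => hne c (by simpa [hw] using L.neg_mem h)
  have hcomm : ∀ x, w * x = x * w := fun x => by
    rw [hw, sub_mul, mul_sub, hz, Algebra.commutes]
  have hbij : Function.Bijective (algebraMap ℂ ((W ⧸ S) →L[ℂ] (W ⧸ S)) c - T) := by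
    constructor
    · rw [injective_iff_map_eq_zero]
      intro q hq
      obtain ⟨x, rfl⟩ := S.mkQ_surjective q
      rw [hap, Submodule.mkQ_apply, Submodule.Quotient.mk_eq_zero, hSmem, hcomm] at hq
      rw [Submodule.mkQ_apply, Submodule.Quotient.mk_eq_zero, hSmem]
      by_contra hx
      let J : Ideal W := Submodule.comap (LinearMap.toSpanSingleton W W w) L
      -- `J` is a left ideal that contains `L` because `w` is central. An `x ∈ J` outside `L` would
      -- give `1 ∈ J` by maximality, that is, `w ∈ L`.
      have hJ : ∀ y, y ∈ J ↔ y * w ∈ L := fun y => Iff.rfl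
      have hlt : L < J := lt_of_le_of_ne
        (fun y hy => by rw [hJ, ← hcomm]; exact L.mul_mem_left _ hy)
        (fun h => hx (by rw [h, hJ]; exact hq))
      have h1 := (Ideal.eq_top_iff_one _).1 (hL.1.2 _ hlt)
      rw [hJ, one_mul] at h1
      exact hwL h1
    · intro q
      obtain ⟨x, rfl⟩ := S.mkQ_surjective q
      -- Surjectivity: `L + W w` is all of `W`, and modulo `L` every element is some `a * w = w *
      -- a`.
      have hlt : L < L ⊔ Ideal.span {w} := lt_of_le_of_ne le_sup_left fun h => hwL (by
        rw [h]; exact Ideal.mem_sup_right (Ideal.mem_span_singleton_self w))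
      have hx : x ∈ L ⊔ Ideal.span {w} := by rw [hL.1.2 _ hlt]; trivial
      obtain ⟨y, hy, v, hv, rfl⟩ := Submodule.mem_sup.1 hx
      obtain ⟨a, rfl⟩ := Ideal.mem_span_singleton'.1 hv
      refine ⟨S.mkQ a, ?_⟩
      rw [hap, map_add, hcomm, (Submodule.Quotient.mk_eq_zero S).2 ((hSmem y).2 hy) |> fun h =>
        (show S.mkQ y = 0 from h), zero_add]
  exact ContinuousLinearMap.isUnit_iff_bijective.2 hbij

/-- A proper left ideal contains no unit, so `c` is in the spectrum of `z`. The factor `‖1‖` appears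
because the unit is not assumed to have norm one. -/
theorem norm_le_of_sub_algebraMap_mem {W : Type*} [NormedRing W] [NormedAlgebra ℂ W]
    [CompleteSpace W] {L : Ideal W} (hL : L ≠ ⊤) {z : W} {c : ℂ}
    (h : z - algebraMap ℂ W c ∈ L) : ‖c‖ ≤ ‖z‖ * ‖(1 : W)‖ := by
  have hc : c ∈ spectrum ℂ z := fun hu => hL
    (L.eq_top_of_isUnit_mem (by simpa using L.neg_mem h) hu)
  simpa using spectrum.subset_closedBall_norm_mul z hc

theorem eq_of_sub_algebraMap_mem {W : Type*} [Ring W] [Algebra ℂ W] {L : Ideal W} (hL : L ≠ ⊤)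
    {z : W} {a b : ℂ} (ha : z - algebraMap ℂ W a ∈ L) (hb : z - algebraMap ℂ W b ∈ L) :
    a = b := by
  by_contra hab
  have h : algebraMap ℂ W (b - a) ∈ L := by
    have := L.sub_mem ha hb
    rwa [sub_sub_sub_cancel_left, ← map_sub] at this
  exact hL (L.eq_top_of_isUnit_mem h
    ((isUnit_iff_ne_zero.2 (sub_ne_zero.2 (Ne.symm hab))).map (algebraMap ℂ W)))

theorem tendsto_const_rpow_one_div {C : ℝ} (hC : 0 < C) :
    Filter.Tendsto (fun n : ℕ => C ^ ((1 : ℝ) / (n : ℝ))) Filter.atTop (nhds 1) := by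
  have h := (tendsto_const_nhds (x := C)).rpow
    (tendsto_one_div_atTop_nhds_zero_nat (𝕜 := ℝ)) (Or.inl hC.ne')
  simpa using h

/-- A number whose powers are dominated by a constant times a sequence of subexponential growth
has modulus at most one. -/
theorem le_one_of_pow_le {r C : ℝ} (hr : 0 ≤ r) (hC : 0 < C) {w : ℕ → ℝ} (hw0 : ∀ n, 0 ≤ w n)
    (hw : Filter.Tendsto (fun n : ℕ => w n ^ ((1 : ℝ) / (n : ℝ))) Filter.atTop (nhds 1))
    (h : ∀ n, r ^ n ≤ w n * C) : r ≤ 1 := by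
  have ht := hw.mul (tendsto_const_rpow_one_div hC)
  rw [one_mul] at ht
  -- `n = 0` is excluded: there `1 / n` is `0` and the root of `r ^ n` does not return `r`.
  refine ge_of_tendsto ht (Filter.eventually_atTop.2 ⟨1, fun n hn => ?_⟩)
  rw [← Real.mul_rpow (hw0 n) hC.le]
  calc r = (r ^ n) ^ ((1 : ℝ) / (n : ℝ)) := by
        rw [one_div, Real.pow_rpow_inv_natCast hr (by omega)]
    _ ≤ _ := Real.rpow_le_rpow (by positivity) (h n) (by positivity)

/-- Wiener's lemma in the form of Bochner and Phillips, for series `∑ D_l u_l` with coefficients in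
a Banach algebra `𝓑` and commuting central `u_l` of subexponential growth: if all
`∑ χ(l) D_l` with unitary characters `χ` are left invertible, then so is `∑ D_l u_l`. -/
theorem exists_left_inverse_tsum {G W 𝓑 : Type*} [AddCommGroup G]
    [NormedRing W] [NormedAlgebra ℂ W] [CompleteSpace W]
    [NormedRing 𝓑] [NormedAlgebra ℂ 𝓑] [CompleteSpace 𝓑]
    (c : 𝓑 →ₐ[ℂ] W) (hc : Continuous c) (u : G → W) (hu0 : u 0 = 1)
    (hu : ∀ l m, u (l + m) = u l * u m) (hcen : ∀ l x, u l * x = x * u l)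
    (w : G → ℝ) (huw : ∀ l, ‖u l‖ ≤ w l)
    (hw : ∀ l, Filter.Tendsto (fun n : ℕ => w (n • l) ^ ((1 : ℝ) / (n : ℝ)))
      Filter.atTop (nhds 1))
    (D : G → 𝓑) (hD : Summable fun l => ‖D l‖) (hDu : Summable fun l => c (D l) * u l)
    (hinv : ∀ χ : AddChar G ℂ, (∀ l, ‖χ l‖ = 1) → ∃ b, b * ∑' l, χ l • D l = 1) :
    ∃ g, g * ∑' l, c (D l) * u l = 1 := by
  by_contra! hne
  set F := ∑' l, c (D l) * u l with hF
  have hspan : Ideal.span {F} ≠ ⊤ := fun h => by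
    obtain ⟨g, hg⟩ := Ideal.mem_span_singleton'.1 ((Ideal.eq_top_iff_one _).1 h)
    exact hne g hg
  obtain ⟨L, hL, hFL⟩ := Ideal.exists_le_maximal _ hspan
  have hLt := hL.ne_top
  have hFmem : F ∈ L := hFL (Ideal.mem_span_singleton_self F)
  choose χ hχ using fun l => exists_sub_algebraMap_mem_of_central L (u l) (hcen l)
  have hχ0 : χ 0 = 1 := eq_of_sub_algebraMap_mem hLt (hχ 0) (by simp [hu0])
  have hχadd : ∀ l m, χ (l + m) = χ l * χ m := fun l m => by
    refine eq_of_sub_algebraMap_mem hLt (hχ (l + m)) ?_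
    -- Multiplicativity modulo a left ideal: only left multiples are used, since scalars commute
    -- with `u l`.
    have h := L.add_mem (L.mul_mem_left (u l) (hχ m))
      (L.mul_mem_left (algebraMap ℂ W (χ m)) (hχ l))
    have he : u l * (u m - algebraMap ℂ W (χ m)) +
        algebraMap ℂ W (χ m) * (u l - algebraMap ℂ W (χ l)) =
        u (l + m) - algebraMap ℂ W (χ l * χ m) := by
      rw [hu, mul_comm (χ l), map_mul, mul_sub, mul_sub, Algebra.commutes (χ m) (u l)]
      abel
    rwa [he] at h
  let ψ : AddChar G ℂ := ⟨χ, hχ0, hχadd⟩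
  have hψ : ∀ l, ψ l = χ l := fun _ => rfl
  have hle : ∀ l, ‖χ l‖ ≤ 1 := fun l => by
    -- `|χ l| ^ n = |χ (n l)|` is at most `w (n l) * ‖1‖`, and `w` has subexponential growth along
    -- `n l`; the `+ 1` only makes the constant positive.
    refine le_one_of_pow_le (norm_nonneg _) (C := ‖(1 : W)‖ + 1) (by positivity)
      (fun n => (norm_nonneg _).trans (huw (n • l))) (hw l) fun n => ?_
    rw [← norm_pow, ← hψ, ← AddChar.map_nsmul_eq_pow, hψ]
    refine (norm_le_of_sub_algebraMap_mem hLt (hχ (n • l))).trans ?_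
    exact mul_le_mul (huw _) (by linarith) (norm_nonneg _) ((norm_nonneg _).trans (huw _))
  have hnorm : ∀ l, ‖χ l‖ = 1 := fun l => by
    refine le_antisymm (hle l) ?_
    have h1 : ‖χ l‖ * ‖χ (-l)‖ = 1 := by
      rw [← norm_mul, ← hχadd, add_neg_cancel, hχ0, norm_one]
    nlinarith [hle l, hle (-l), norm_nonneg (χ l), norm_nonneg (χ (-l))]
  obtain ⟨b, hb⟩ := hinv ψ hnorm
  have hDχ : Summable fun l => ψ l • D l :=
    Summable.of_norm_bounded hD fun l => by rw [norm_smul, hψ, hnorm, one_mul]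
  have hcD : HasSum (fun l => c (ψ l • D l)) (c (∑' l, ψ l • D l)) := hDχ.hasSum.map c hc
  have hdiff := hDu.hasSum.sub hcD
  have hcl : IsClosed (L : Set W) := by
    rw [← hL.closure_eq]; exact isClosed_closure
  -- Each term of the difference is `c (D l) * (u l - χ l)`. With the coefficient on the left it
  -- stays in the left ideal, and `L` is closed.
  have hmem : F - c (∑' l, ψ l • D l) ∈ L := by
    refine hcl.mem_of_tendsto hdiff (Filter.Eventually.of_forall fun s => ?_)
    refine L.sum_mem fun l _ => ?_
    have he : c (D l) * u l - c (ψ l • D l) = c (D l) * (u l - algebraMap ℂ W (χ l)) := by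
      rw [map_smul, mul_sub, ← Algebra.commutes, ← Algebra.smul_def, hψ]
    rw [he]
    exact L.mul_mem_left _ (hχ l)
  have h1 : c (∑' l, ψ l • D l) ∈ L := by simpa using L.sub_mem hFmem hmem
  have h2 := L.mul_mem_left (c b) h1
  rw [← map_mul, hb, map_one] at h2
  exact hLt ((Ideal.eq_top_iff_one _).2 h2)

noncomputable section

namespace BGS

/-! ### Laurent matrices and the centralizer of the translations -/

section SideDiagonal

variable {d : ℕ} {ν : SubmulSymmWeight d} {K : Type*} [NormedAddCommGroup K]
  [InnerProductSpace ℂ K]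

theorem toReal_latticeVal (ν : SubmulSymmWeight d) (l : IntLattice d) :
    (ν.latticeVal l).toReal = ν.toFun (latticePoint l) :=
  ENNReal.toReal_ofReal (ν.pos' _).le

theorem bgsENorm_sideDiagonal_le (ν : SubmulSymmWeight d) (l : IntLattice d) (T : K →L[ℂ] K) :
    bgsENorm ν (fun k j => if k - j = l then T else 0) ≤ ‖T‖ₑ * ν.latticeVal l := by
  unfold bgsENorm sideDiag
  rw [tsum_eq_single l]
  · gcongr
    exact iSup_le fun k => by simp
  · intro m hm
    simp [hm, enorm_eq_nnnorm]

/-- The matrix with constant entry `T` on the `l`-th side diagonal and zeros elsewhere. -/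
def sideDiagonal (ν : SubmulSymmWeight d) (l : IntLattice d) (T : K →L[ℂ] K) : BGS ν K :=
  mk (fun k j => if k - j = l then T else 0)
    ((bgsENorm_sideDiagonal_le ν l T).trans_lt (ENNReal.mul_lt_top enorm_lt_top
      ENNReal.ofReal_lt_top))

theorem entry_sideDiagonal (l : IntLattice d) (T : K →L[ℂ] K) (k j : IntLattice d) :
    (sideDiagonal ν l T).entry k j = if k - j = l then T else 0 := rfl

theorem norm_sideDiagonal_le (l : IntLattice d) (T : K →L[ℂ] K) :
    ‖sideDiagonal ν l T‖ ≤ ‖T‖ * ν.toFun (latticePoint l) := by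
  have h := ENNReal.toReal_mono (ENNReal.mul_lt_top enorm_lt_top ENNReal.ofReal_lt_top).ne
    (bgsENorm_sideDiagonal_le ν l T)
  rwa [ENNReal.toReal_mul, toReal_enorm, ENNReal.toReal_ofReal (ν.pos' _).le] at h

theorem entry_mul_sideDiagonal (G : BGS ν K) (l : IntLattice d) (T : K →L[ℂ] K)
    (k j : IntLattice d) : (G * sideDiagonal ν l T).entry k j = G.entry k (l + j) * T := by
  rw [entry_mul, matMul, tsum_eq_single (l + j)]
  · simp [entry_sideDiagonal]
  · intro n hn
    rw [entry_sideDiagonal, if_neg (fun h => hn (by rw [← h, sub_add_cancel])), mul_zero]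

theorem sideDiagonal_mul (l m : IntLattice d) (S T : K →L[ℂ] K) :
    sideDiagonal ν l S * sideDiagonal ν m T = sideDiagonal ν (l + m) (S * T) := by
  ext1
  funext k j
  rw [entry_mul_sideDiagonal, entry_sideDiagonal, entry_sideDiagonal]
  have : k - (m + j) = l ↔ k - j = l + m := by
    rw [sub_eq_iff_eq_add, sub_eq_iff_eq_add, add_assoc]
  simp only [this, ite_mul, zero_mul]

theorem sideDiagonal_add (l : IntLattice d) (S T : K →L[ℂ] K) :
    sideDiagonal ν l (S + T) = sideDiagonal ν l S + sideDiagonal ν l T := by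
  ext1
  funext k j
  rw [entry_add, Pi.add_apply, Pi.add_apply]
  simp only [entry_sideDiagonal]
  split_ifs <;> simp

theorem sideDiagonal_smul (l : IntLattice d) (a : ℂ) (T : K →L[ℂ] K) :
    sideDiagonal ν l (a • T) = a • sideDiagonal ν l T := by
  ext1
  funext k j
  rw [entry_smul, Pi.smul_apply, Pi.smul_apply]
  simp only [entry_sideDiagonal]
  split_ifs <;> simp

variable (ν) in
/-- The entry at a given position, as a continuous linear map on `C_ν`. -/
def entryCLM (K : Type*) [NormedAddCommGroup K] [InnerProductSpace ℂ K] (k j : IntLattice d) :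
    BGS ν K →L[ℂ] (K →L[ℂ] K) :=
  LinearMap.mkContinuous
    { toFun := fun A => A.entry k j, map_add' := fun _ _ => rfl, map_smul' := fun _ _ => rfl } 1
    (fun A => by rw [one_mul]; exact norm_entry_le A k j)

theorem entryCLM_apply (A : BGS ν K) (k j : IntLattice d) :
    entryCLM ν K k j A = A.entry k j := rfl

theorem sideDiagonal_zero_one : sideDiagonal ν 0 (1 : K →L[ℂ] K) = 1 := by
  ext1
  funext k j
  rw [entry_sideDiagonal, entry_one, matOne]
  simp only [sub_eq_zero]

variable [CompleteSpace K]

variable (ν K) in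
/-- The subalgebra of `C_ν` of the matrices that commute with all translations. -/
def translationInvariant : Subalgebra ℂ (BGS ν K) :=
  Subalgebra.centralizer ℂ (Set.range fun l => sideDiagonal ν l (1 : K →L[ℂ] K))

theorem sideDiagonal_mem_translationInvariant (l : IntLattice d) (T : K →L[ℂ] K) :
    sideDiagonal ν l T ∈ translationInvariant ν K := by
  rw [translationInvariant, Subalgebra.mem_centralizer_iff]
  rintro _ ⟨m, rfl⟩
  simp only [sideDiagonal_mul, one_mul, mul_one, add_comm]

instance : CompleteSpace (translationInvariant ν K) :=
  IsClosed.completeSpace_coe (hs := Set.isClosed_centralizer _)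

variable (ν K) in
/-- The constant main diagonals, as an algebra homomorphism. -/
def constDiagonal : (K →L[ℂ] K) →ₐ[ℂ] translationInvariant ν K :=
  AlgHom.ofLinearMap
    { toFun := fun T => ⟨sideDiagonal ν 0 T, sideDiagonal_mem_translationInvariant 0 T⟩
      map_add' := fun S T => Subtype.ext (sideDiagonal_add 0 S T)
      map_smul' := fun a T => Subtype.ext (sideDiagonal_smul 0 a T) }
    (Subtype.ext sideDiagonal_zero_one)
    (fun S T => Subtype.ext (by
      change sideDiagonal ν 0 (S * T) = sideDiagonal ν 0 S * sideDiagonal ν 0 T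
      rw [sideDiagonal_mul, add_zero]))

theorem continuous_constDiagonal : Continuous (constDiagonal ν K) :=
  AddMonoidHomClass.continuous_of_bound (constDiagonal ν K) (ν.toFun (latticePoint 0)) fun T => by
    rw [mul_comm]
    exact norm_sideDiagonal_le 0 T

/-- The translation by `l`. -/
def translation (l : IntLattice d) : translationInvariant ν K :=
  ⟨sideDiagonal ν l 1, sideDiagonal_mem_translationInvariant l 1⟩

theorem constDiagonal_mul_translation (l : IntLattice d) (T : K →L[ℂ] K) :
    ((constDiagonal ν K T * translation l : translationInvariant ν K) : BGS ν K) =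
      sideDiagonal ν l T := by
  change sideDiagonal ν 0 T * sideDiagonal ν l 1 = _
  rw [sideDiagonal_mul, zero_add, mul_one]

end SideDiagonal

theorem tendsto_weight_nsmul {d : ℕ} {ν : SubmulSymmWeight d} (hGRS : ν.GRS) (l : IntLattice d) :
    Filter.Tendsto (fun n : ℕ => ν.toFun (latticePoint (n • l)) ^ ((1 : ℝ) / (n : ℝ)))
      Filter.atTop (nhds 1) := by
  have h : ∀ n : ℕ, latticePoint (n • l) = (n : ℝ) • latticePoint l := fun n => by
    ext i; simp [latticePoint]
  simpa only [h] using hGRS (latticePoint l)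

/-- If all `∑ χ(l) D_l` with unitary characters `χ` of `ℤᵈ` are left invertible, then so is the
Laurent matrix with symbol `D`. -/
theorem exists_left_inverse_laurent {d : ℕ} {ν : SubmulSymmWeight d} (hGRS : ν.GRS)
    {K : Type*} [NormedAddCommGroup K] [InnerProductSpace ℂ K] [CompleteSpace K]
    (D : IntLattice d → (K →L[ℂ] K))
    (hD : Summable fun l => ‖D l‖ * ν.toFun (latticePoint l))
    (hinv : ∀ χ : AddChar (IntLattice d) ℂ, (∀ l, ‖χ l‖ = 1) → ∃ b, b * ∑' l, χ l • D l = 1) :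
    ∃ G : BGS ν K, HasSum (fun l => G * sideDiagonal ν l (D l)) 1 := by
  have hone : ∀ l : IntLattice d, ‖(translation l : translationInvariant ν K)‖ ≤
      ν.toFun (latticePoint l) := fun l =>
    (norm_sideDiagonal_le l (1 : K →L[ℂ] K)).trans
      (mul_le_of_le_one_left (ν.pos' _).le ContinuousLinearMap.norm_id_le)
  -- This is the Laurent series with symbol `D`; the weighted summability of `D` is what makes it
  -- converge in the norm of `C_ν`.
  have hDu : Summable fun l => constDiagonal ν K (D l) * translation l :=
    Summable.of_norm_bounded hD fun l => by
      have h := norm_sideDiagonal_le (ν := ν) l (D l)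
      rwa [← constDiagonal_mul_translation] at h
  obtain ⟨g, hg⟩ := exists_left_inverse_tsum (constDiagonal ν K) continuous_constDiagonal
    translation (Subtype.ext sideDiagonal_zero_one)
    (fun l m => Subtype.ext (by
      change sideDiagonal ν (l + m) 1 = sideDiagonal ν l 1 * sideDiagonal ν m 1
      rw [sideDiagonal_mul, mul_one]))
    (fun l x => Subtype.ext ((Subalgebra.mem_centralizer_iff ℂ).1 x.2 _ ⟨l, rfl⟩))
    (fun l => ν.toFun (latticePoint l)) hone (tendsto_weight_nsmul hGRS) D
    (Summable.of_nonneg_of_le (fun l => norm_nonneg _)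
      (fun l => le_mul_of_one_le_right (norm_nonneg _) (ν.one_le _)) hD) hDu hinv
  refine ⟨g, ?_⟩
  have h1 := hDu.hasSum.mul_left g
  rw [hg] at h1
  have h2 := h1.map (translationInvariant ν K).val continuous_subtype_val
  refine h2.congr_fun fun l => ?_
  rw [← constDiagonal_mul_translation]
  rfl

/-! ### From the Laurent matrix back to the original matrix -/

section Inverse

variable {d : ℕ} {ν : SubmulSymmWeight d} {H : Type*} [NormedAddCommGroup H]
  [InnerProductSpace ℂ H]

/-- The entry at position `(k, j)` of the matrix of a bounded operator on `ℓ²(ℤᵈ; H)`. -/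
def block (T : SeqL2 d H →L[ℂ] SeqL2 d H) (k j : IntLattice d) : H →L[ℂ] H :=
  (evalCLM k).comp (T.comp (lp.singleContinuousLinearMap ℂ (fun _ : IntLattice d => H) 2 j))

theorem block_apply (T : SeqL2 d H →L[ℂ] SeqL2 d H) (k j : IntLattice d) (x : H) :
    block T k j x = T (lp.single 2 j x) k := rfl

theorem norm_block_le (T : SeqL2 d H →L[ℂ] SeqL2 d H) (k j : IntLattice d) :
    ‖block T k j‖ ≤ ‖T‖ :=
  ContinuousLinearMap.opNorm_le_bound _ (norm_nonneg T) fun x => by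
    rw [block_apply]
    refine (lp.norm_apply_le_norm (by norm_num) _ k).trans ?_
    refine (T.le_opNorm _).trans_eq ?_
    rw [lp.norm_single (by norm_num)]

variable (d H) in
/-- The entry at position `(k, j)`, as a continuous linear map. -/
def blockCLM (k j : IntLattice d) : (SeqL2 d H →L[ℂ] SeqL2 d H) →L[ℂ] (H →L[ℂ] H) :=
  LinearMap.mkContinuous
    { toFun := fun T : SeqL2 d H →L[ℂ] SeqL2 d H => block T k j, map_add' := fun _ _ => rfl, map_smul' := fun _ _ => rfl } 1
    (fun T => by rw [one_mul]; exact norm_block_le T k j)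

theorem blockCLM_apply (T : SeqL2 d H →L[ℂ] SeqL2 d H) (k j : IntLattice d) :
    blockCLM d H k j T = block T k j := rfl

theorem block_one (k j : IntLattice d) :
    block (1 : SeqL2 d H →L[ℂ] SeqL2 d H) k j = matOne d H k j := by
  ext x
  exact isMatrixOf_one.apply_single k j x

/-- Passing to a block does not increase the norm of an entry, so compressing a matrix over `ℓ²(ℤᵈ;
H)` to one over `H` stays in `C_ν`. -/
theorem bgsENorm_block_le (G : BGS ν (SeqL2 d H)) :
    bgsENorm ν (fun k j => block (G.entry k j) k j) ≤ bgsENorm ν G.entry := by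
  unfold bgsENorm sideDiag
  refine ENNReal.tsum_le_tsum fun l => ?_
  gcongr with k
  rw [← ofReal_norm, ← ofReal_norm]
  exact ENNReal.ofReal_le_ofReal (norm_block_le _ _ _)

theorem sideDiag_ne_top (A : BGS ν H) (l : IntLattice d) : sideDiag A.entry l ≠ ⊤ :=
  ((sideDiag_le_enorm ν A.entry l).trans_lt A.enorm_lt).ne

/-- A side diagonal acts as a shift followed by a block-diagonal operator, so its operator norm is
at most the supremum of its entries; the weighted sum is thus controlled by the norm of `A`. -/
theorem exists_sideDiagonal_operators (A : BGS ν H) :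
    ∃ D : IntLattice d → (SeqL2 d H →L[ℂ] SeqL2 d H),
      (∀ l f k, D l f k = A.entry k (k - l) (f (k - l))) ∧
      Summable fun l => ‖D l‖ * ν.toFun (latticePoint l) := by
  have hbd : ∀ l k, ‖A.entry k (k - l)‖ ≤ (sideDiag A.entry l).toReal := fun l k => by
    have h1 : ‖A.entry k (k - l)‖ₑ ≤ sideDiag A.entry l :=
      le_iSup (fun k => ‖A.entry k (k - l)‖ₑ) k
    simpa using ENNReal.toReal_mono (sideDiag_ne_top A l) h1
  choose D hD hDa using fun l => exists_diag (fun k => A.entry k (k - l)) l _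
    ENNReal.toReal_nonneg (hbd l)
  refine ⟨D, hDa, Summable.of_nonneg_of_le
    (fun l => mul_nonneg (norm_nonneg (D l)) (ν.pos' _).le)
    (fun l => mul_le_mul_of_nonneg_right (hD l) (ν.pos' _).le) ?_⟩
  have h := ENNReal.summable_toReal A.enorm_lt.ne
  refine h.congr fun l => ?_
  rw [ENNReal.toReal_mul, toReal_latticeVal]

variable [CompleteSpace H]

theorem hasSum_sideDiagonal_operators (A : BGS ν H)
    {D : IntLattice d → (SeqL2 d H →L[ℂ] SeqL2 d H)}
    (hD : ∀ l f k, D l f k = A.entry k (k - l) (f (k - l))) (f : SeqL2 d H) (k : IntLattice d) :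
    HasSum (fun l => D l f k) (A.toOp f k) := by
  have h := (Equiv.subLeft k).hasSum_iff.2 (A.isMatrixOf_toOp f k)
  exact h.congr_fun fun l => by simp [hD]

/-- The modulation `f ↦ χ f` by a unitary character. -/
theorem exists_modulation (χ : AddChar (IntLattice d) ℂ) (hχ : ∀ l, ‖χ l‖ = 1) :
    ∃ M : SeqL2 d H →L[ℂ] SeqL2 d H, ∀ f k, M f k = χ k • f k := by
  obtain ⟨M, -, hM⟩ := exists_diag (fun k => χ k • (1 : H →L[ℂ] H)) 0 1 zero_le_one fun k => by
    rw [norm_smul, hχ, one_mul]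
    exact ContinuousLinearMap.norm_id_le
  exact ⟨M, fun f k => by simp [hM]⟩

/-- With `M` the modulation by `χ` and `N` its inverse, `∑ χ(l) D l = M A N`, since `χ(-k) χ(l) =
χ(-(k - l))`. Hence `M b N` is a left inverse. -/
theorem exists_left_inverse_modulated (A : BGS ν H)
    {D : IntLattice d → (SeqL2 d H →L[ℂ] SeqL2 d H)}
    (hD : ∀ l f k, D l f k = A.entry k (k - l) (f (k - l))) (hDs : Summable fun l => ‖D l‖)
    {b : SeqL2 d H →L[ℂ] SeqL2 d H} (hb : b * A.toOp = 1)
    (χ : AddChar (IntLattice d) ℂ) (hχ : ∀ l, ‖χ l‖ = 1) : ∃ c, c * ∑' l, χ l • D l = 1 := by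
  obtain ⟨M, hM⟩ := exists_modulation (H := H) χ hχ
  obtain ⟨N, hN⟩ := exists_modulation (H := H) χ⁻¹ fun l => by
    rw [AddChar.inv_apply, hχ]
  have hne : ∀ k, χ k * χ (-k) = 1 := fun k => by
    rw [← AddChar.map_add_eq_mul, add_neg_cancel, AddChar.map_zero_eq_one]
  have hMN : M * N = 1 := by
    ext f k
    rw [mul_apply_eq_comp, hM, hN, AddChar.inv_apply, smul_smul, hne, one_smul]
    rfl
  have hχD : Summable fun l => χ l • D l :=
    Summable.of_norm_bounded hDs fun l => by rw [norm_smul, hχ, one_mul]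
  have hconj : N * ∑' l, χ l • D l = A.toOp * N := by
    ext f k
    have h1 := ((evalCLM (H := H) k).comp
      (ContinuousLinearMap.apply ℂ (SeqL2 d H) f)).hasSum (hχD.hasSum.mul_left N)
    refine HasSum.unique h1 ((hasSum_sideDiagonal_operators A hD (N f) k).congr_fun fun l => ?_)
    change (N * χ l • D l) f k = _
    rw [mul_apply_eq_comp, hN, hD, hN, smul_apply, map_smul]
    change χ⁻¹ k • χ l • D l f k = _
    rw [hD, smul_smul, AddChar.inv_apply, AddChar.inv_apply, ← AddChar.map_add_eq_mul, neg_sub,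
      neg_add_eq_sub]
  refine ⟨M * b * N, ?_⟩
  rw [mul_assoc, hconj, mul_assoc, ← mul_assoc b, hb, one_mul, hMN]

/-- The entry `(k, j)` of `G` times the Laurent matrix is `∑ G_{k,l+j} D_l`. On its block `(k, j)`,
the operator `D_l` sends position `j` to position `l + j` only, through `A_{l+j,j}`. So just the
block `(k, l + j)` of `G_{k,l+j}` enters, and the sum is a matrix product with `A`. -/
theorem exists_left_inverse (hGRS : ν.GRS) (A : BGS ν H)
    {b : SeqL2 d H →L[ℂ] SeqL2 d H} (hb : b * A.toOp = 1) : ∃ B : BGS ν H, B * A = 1 := by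
  obtain ⟨D, hD, hDs⟩ := exists_sideDiagonal_operators A
  have hDs' : Summable fun l => ‖D l‖ := Summable.of_nonneg_of_le (fun l => norm_nonneg _)
    (fun l => le_mul_of_one_le_right (norm_nonneg _) (ν.one_le _)) hDs
  obtain ⟨G, hG⟩ := exists_left_inverse_laurent hGRS D hDs
    (exists_left_inverse_modulated A hD hDs' hb)
  refine ⟨mk (fun k j => block (G.entry k j) k j) ((bgsENorm_block_le G).trans_lt G.enorm_lt), ?_⟩
  ext1
  funext k j
  have h1 := ((blockCLM d H k j).comp (entryCLM ν (SeqL2 d H) k j)).hasSum hG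
  have h2 : ((blockCLM d H k j).comp (entryCLM ν (SeqL2 d H) k j)) (1 : BGS ν (SeqL2 d H)) =
      matOne d H k j := by
    rw [ContinuousLinearMap.comp_apply, entryCLM_apply, blockCLM_apply, entry_one]
    by_cases h : k = j
    · rw [matOne, if_pos h, block_one]
    · rw [matOne, matOne, if_neg h, if_neg h]
      rfl
  rw [h2] at h1
  rw [entry_one, entry_mul, matMul, entry_mk]
  refine HasSum.tsum_eq ?_
  -- The summation index of the matrix product is `n = l + j`.
  refine (Equiv.addRight j).hasSum_iff.1 (h1.congr_fun fun l => ?_)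
  rw [ContinuousLinearMap.comp_apply, entryCLM_apply, blockCLM_apply, entry_mul_sideDiagonal]
  ext x
  have h3 : D l (lp.single 2 j x) = lp.single 2 (l + j) (A.entry (l + j) j x) := by
    ext m
    rw [hD]
    by_cases hm : m = l + j
    · subst hm
      simp [lp.single_apply]
    · have : m - l ≠ j := fun h => hm (by rw [← h, add_sub_cancel])
      simp [lp.single_apply, hm, this]
  change block (G.entry k (l + j)) k (l + j) (A.entry (l + j) j x) = _
  rw [block_apply, block_apply, mul_apply_eq_comp, h3]

theorem isWienerPair_inclusion (hGRS : ν.GRS) : IsWienerPair (inclusion ν H) where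
  injective := toOp_injective
  inverse_closed a b hab hba := by
    change a.toOp * b = 1 at hab
    change b * a.toOp = 1 at hba
    obtain ⟨c, hc⟩ := exists_left_inverse hGRS a hba
    refine ⟨c, ?_⟩
    change c.toOp = b
    have h : c.toOp * a.toOp = 1 := by rw [← toOp_mul, hc, toOp_one]
    -- The left inverse from `C_ν` agrees with the given inverse because `b` is also a right
    -- inverse.
    exact left_inv_eq_right_inv h hab

end Inverse

end BGS

/-! ### Spectral invariance and symmetry -/

/-- In a Wiener pair, invertibility and hence the spectrum do not depend on the algebra. -/
theorem IsWienerPair.isUnit_of_isUnit_map {𝒜 ℬ : Type*}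
    [NormedRing 𝒜] [NormedAlgebra ℂ 𝒜] [CompleteSpace 𝒜]
    [StarRing 𝒜] [StarModule ℂ 𝒜] [NormedStarGroup 𝒜]
    [NormedRing ℬ] [NormedAlgebra ℂ ℬ] [CompleteSpace ℬ]
    [StarRing ℬ] [StarModule ℂ ℬ] [NormedStarGroup ℬ]
    {ι : 𝒜 →⋆ₐ[ℂ] ℬ} (h : IsWienerPair ι) {a : 𝒜} (ha : IsUnit (ι a)) : IsUnit a := by
  obtain ⟨b, hab, hba⟩ := isUnit_iff_exists.1 ha
  obtain ⟨c, rfl⟩ := h.inverse_closed a b hab hba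
  refine isUnit_iff_exists.2 ⟨c, h.injective ?_, h.injective ?_⟩
  · rw [map_mul, hab, map_one]
  · rw [map_mul, hba, map_one]

open scoped ComplexOrder in
/-- An inverse-closed *-subalgebra of a C*-algebra is symmetric. -/
theorem IsWienerPair.isSymmetricBanachAlgebra {𝒜 ℬ : Type*}
    [NormedRing 𝒜] [NormedAlgebra ℂ 𝒜] [CompleteSpace 𝒜]
    [StarRing 𝒜] [StarModule ℂ 𝒜] [NormedStarGroup 𝒜] [CStarAlgebra ℬ]
    {ι : 𝒜 →⋆ₐ[ℂ] ℬ} (h : IsWienerPair ι) : IsSymmetricBanachAlgebra 𝒜 := by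
  let _ := CStarAlgebra.spectralOrder ℬ
  have := CStarAlgebra.spectralOrderedRing ℬ
  intro a z hz
  -- Inverse-closedness moves the spectral value to the C*-algebra, where `star (ι a) * ι a` is
  -- positive for the spectral order.
  have hz' : z ∈ spectrum ℂ (star (ι a) * ι a) := fun hu => hz
    (h.isUnit_of_isUnit_map (by
      rwa [map_sub, map_mul, map_star, AlgHomClass.commutes]))
  have h0 := spectrum_nonneg_of_nonneg (star_mul_self_nonneg (ι a)) hz'
  exact ⟨z.re, (Complex.le_def.1 h0).1, Complex.ext rfl (Complex.le_def.1 h0).2⟩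

end

theorem theorem6p3 {d : ℕ} {H : Type*} [NormedAddCommGroup H] [InnerProductSpace ℂ H]
    [CompleteSpace H] [TopologicalSpace.SeparableSpace H]
    (ν : SubmulSymmWeight d) (hGRS : ν.GRS) :
    IsWienerPair (BGS.inclusion ν H) ∧ IsSymmetricBanachAlgebra (BGS ν H) :=
  ⟨BGS.isWienerPair_inclusion hGRS, (BGS.isWienerPair_inclusion hGRS).isSymmetricBanachAlgebra⟩
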